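/- All graphs are finite and simple. For a graph $F$ and $n\in\mathbb N$, let $\mathrm{ex}(n,F)$ be the maximum number of edges of an $n$-vertex graph that does not contain $F$ as a (not necessarily induced) subgraph, and let $\mathrm{rex}(n,F)$ be the maximum number of edges of a *regular* $n$-vertex graph that does not contain $F$ as a subgraph. $K_m$ is the complete graph on $m$ vertices and $\chi(F)$ is the chromatic number of $F$. **Theorem.** Let $r\ge 3$ be an integer. (i) If $n$ is a multiple of $r$, then $\mathrm{rex}(n,K_{r+1})=\mathrm{ex}(n,K_{r+1})$. (ii) If $n$ is not a multiple of $r$, then $\mathrm{rex}(n,K_{r+1})=\mathrm{ex}(n,K_{r+1})-\Theta(n)$ as $n\to\infty$; that is, there are constants $c,C>0$ and $N$, depending only on $r$, such that $cn\le \mathrm{ex}(n,K_{r+1})-\mathrm{rex}(n,K_{r+1})\le Cn$ for all $n\ge N$ with $r\nmid n$. (iii) If $n=qr+s$ with integers $q\ge 0$ and $1\le s\le r-2$, and at least one of $r-s$ and $q$ is even, then $$\mathrm{rex}(n,K_{r+1})=\mathrm{ex}(n,K_{r+1})-\frac{(r-s)\,q}{2}.$$ (iv) If $F$ is any graph with $\chi(F)\ge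 4$, then $\mathrm{rex}(n,F)=(1-o(1))\,\mathrm{ex}(n,F)$ as $n\to\infty$. (v) If $n=3k+s$ with $s\in\{0,1,2\}$ and $n\notin\{2,8\}$, then $\mathrm{rex}(n,K_4)=kn=n\left\lfloor \frac n3\right\rfloor$. -/

import Mathlib

namespace RegularTuran

open scoped Classical in
/-- The regular Turán number `rex(n, F)`: the maximum number of edges in a regular graph on `n`
vertices that does not contain `F` as a (not necessarily induced) subgraph. As for
`SimpleGraph.extremalNumber`, the value is `0` if there is no such graph; this does not happen
when `F` has an edge, since then the edgeless graph is regular and `F`-free. -/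
noncomputable def rex (n : ℕ) {W : Type*} (F : SimpleGraph W) : ℕ :=
  Finset.sup {G : SimpleGraph (Fin n) | (∃ d, G.IsRegularOfDegree d) ∧ F.Free G}
    (fun G => G.edgeFinset.card)

end RegularTuran

namespace RegularTuran

open Finset SimpleGraph Filter

/-! Write `n = q * r + s`, let `t = r - s` be the number of parts of size `q` in the Turán graph,
and let `s > 0`. Its average degree exceeds `n - (q + 1)` by `t * q / n < 1`, so a regular
`K_{r+1}`-free graph has degree at most `n - (q + 1)`, which costs at least `t * q / 2` edges. For
lower bounds, take a complete multipartite graph with parts of sizes `b` and `b + j` and delete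
`j`-regular bipartite graphs between the small parts. This is possible if their number is even (pair
them) or if `b` is even and there are at least two (halve each part and link the halves cyclically).
With `j = 1` the bound is attained; with bounded `j` every large `n` is reached at a linear loss,
and Erdős–Stone then gives the asymptotics for general `F`. For `K_4` and `n = 3 * k + 2` there is
only one small part, and degree `2 * k + 1` is excluded by parity or by the Andrásfai–Erdős–Sós
theorem. -/

/-! ### Regular multipartite graphs -/

open scoped Classical in
/-- Removing a graph `H` from the complete multipartite graph given by `col` leaves a regular
graph as soon as the size of a part plus the degree in `H` is constant. -/
theorem exists_regular_of_multipartite_sdiff {V K : Type*} [Fintype V] (col : V → K)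
    (H : SimpleGraph V) (hH : ∀ u v, H.Adj u v → col u ≠ col v) (a n : ℕ)
    (hn : Fintype.card V = n)
    (ha : ∀ v, #{u | col u = col v} + H.degree v = a) :
    ∃ G : SimpleGraph (Fin n), G.IsRegularOfDegree (n - a) ∧ Nonempty (G.Coloring K) := by
  let G : SimpleGraph V :=
    { Adj := fun u v => col u ≠ col v ∧ ¬ H.Adj u v
      symm := ⟨fun u v h => ⟨h.1.symm, fun h' => h.2 h'.symm⟩⟩
      loopless := ⟨fun u h => h.1 rfl⟩ }
  have hdeg : ∀ v, G.degree v = n - a := by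
    intro v
    have h1 : G.neighborFinset v =
        (univ.filter (fun u => col u = col v) ∪ H.neighborFinset v)ᶜ := by
      ext u
      simp only [mem_neighborFinset, mem_compl, mem_union, mem_filter, mem_univ, true_and, G,
        H.adj_comm v u]
      grind
    have h2 : Disjoint (univ.filter fun u => col u = col v) (H.neighborFinset v) := by
      rw [Finset.disjoint_left]
      intro u hu hu'
      simp only [mem_filter, mem_univ, true_and, mem_neighborFinset] at hu hu'
      exact hH _ _ hu' hu.symm
    rw [← card_neighborFinset_eq_degree, h1, card_compl, card_union_of_disjoint h2,
      card_neighborFinset_eq_degree, ha, hn]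
  let e : Fin n ≃ V := (Fintype.equivFinOfCardEq hn).symm
  let f : G.comap e ≃g G := Iso.comap e G
  refine ⟨G.comap e, fun v => ?_, ⟨⟨fun v => col (e v), fun {u v} h => ?_⟩⟩⟩
  · rw [← hdeg (e v)]
    convert (f.degree_eq v).symm
    rfl
  · exact h.1

open scoped Classical in
/-- A relation on `Fin h` all of whose rows and columns have exactly `j` elements. -/
theorem exists_biregular_relation (h j : ℕ) (hj : h = 0 ∨ j ≤ h) :
    ∃ R : Fin h → Fin h → Prop, (∀ x, #{y | R x y} = j) ∧ ∀ y, #{x | R x y} = j := by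
  rcases h with _ | h
  · exact ⟨fun _ _ => True, fun x => x.elim0, fun x => x.elim0⟩
  have hj' : j ≤ #(univ : Finset (Fin (h + 1))) := by simp; omega
  obtain ⟨T, -, hT⟩ := exists_subset_card_eq hj'
  -- A circulant relation on the cyclic group `Fin (h + 1)`.
  refine ⟨fun x y => y - x ∈ T, fun x => ?_, fun y => ?_⟩
  · rw [← hT]
    refine card_bij' (fun y _ => y - x) (fun t _ => t + x) ?_ ?_ ?_ ?_ <;> simp
  · rw [← hT]
    refine card_bij' (fun x _ => y - x) (fun t _ => y - t) ?_ ?_ ?_ ?_ <;> simp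

/-- The union over `I` of copies of the bipartite graph with biadjacency relation `R`, together
with isolated vertices. -/
def matchedPairs (I S : Type*) {X : Type*} (R : X → X → Prop) :
    SimpleGraph ((I × Bool × X) ⊕ S) where
  Adj u v := match u, v with
    | .inl (i, false, x), .inl (i', true, y) => i = i' ∧ R x y
    | .inl (i, true, x), .inl (i', false, y) => i = i' ∧ R y x
    | _, _ => False
  symm := ⟨by
    rintro (⟨i, _ | _, x⟩ | u) (⟨i', _ | _, y⟩ | v) <;> simp +contextual⟩
  loopless := ⟨by rintro (⟨i, _ | _, x⟩ | u) <;> simp⟩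

section matchedPairs

variable {I S X : Type*} (R : X → X → Prop) (i i' : I) (x y : X) (u : S)

@[simp]
theorem matchedPairs_adj_false_true :
    (matchedPairs I S R).Adj (.inl (i, false, x)) (.inl (i', true, y)) ↔ i = i' ∧ R x y := Iff.rfl

@[simp]
theorem matchedPairs_adj_true_false :
    (matchedPairs I S R).Adj (.inl (i, true, x)) (.inl (i', false, y)) ↔ i = i' ∧ R y x := Iff.rfl

@[simp]
theorem not_matchedPairs_adj_false_false :
    ¬ (matchedPairs I S R).Adj (.inl (i, false, x)) (.inl (i', false, y)) := id

@[simp]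
theorem not_matchedPairs_adj_true_true :
    ¬ (matchedPairs I S R).Adj (.inl (i, true, x)) (.inl (i', true, y)) := id

@[simp]
theorem not_matchedPairs_adj_inr (v : (I × Bool × X) ⊕ S) :
    ¬ (matchedPairs I S R).Adj (.inr u) v := by
  rcases v with ⟨i, _ | _, x⟩ | u <;> exact id

@[simp]
theorem not_matchedPairs_adj_inr_right (v : (I × Bool × X) ⊕ S) :
    ¬ (matchedPairs I S R).Adj v (.inr u) := by
  rcases v with ⟨i, _ | _, x⟩ | u <;> exact id

end matchedPairs

open scoped Classical in
theorem matchedPairs_degree {I X : Type*} {S : Type*} [Fintype I] [Fintype X] [Fintype S]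
    (R : X → X → Prop) (j : ℕ) (hR1 : ∀ x, #{y | R x y} = j) (hR2 : ∀ y, #{x | R x y} = j)
    (u : I × Bool × X) : (matchedPairs I S R).degree (.inl u) = j := by
  obtain ⟨i, b, x⟩ := u
  rw [← card_neighborFinset_eq_degree]
  cases b
  · rw [← hR1 x]
    symm
    refine card_bij (fun y _ => .inl (i, true, y)) (fun y hy => ?_) (by simp) ?_
    · rw [mem_neighborFinset]
      simpa using hy
    · rintro (⟨i', _ | _, y⟩ | v) hv <;> rw [mem_neighborFinset] at hv <;> simp at hv
      exact ⟨y, by simp [hv], by simp [hv]⟩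
  · rw [← hR2 x]
    symm
    refine card_bij (fun y _ => .inl (i, false, y)) (fun y hy => ?_) (by simp) ?_
    · rw [mem_neighborFinset]
      simpa using hy
    · rintro (⟨i', _ | _, y⟩ | v) hv <;> rw [mem_neighborFinset] at hv <;> simp at hv
      exact ⟨y, by simp [hv], by simp [hv]⟩

open scoped Classical in
theorem matchedPairs_degree_inr {I X : Type*} {S : Type*} [Fintype I] [Fintype X] [Fintype S]
    (R : X → X → Prop) (u : S) :
    (matchedPairs I S R).degree (.inr u) = 0 := by
  rw [← card_neighborFinset_eq_degree, card_eq_zero]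
  ext v
  simp

open scoped Classical in
/-- Regular multipartite graphs with parts of two sizes: `s` parts of size `m * h + j`, and parts
of size `m * h`, grouped in pairs by `κ`, between which `j`-regular graphs are removed. -/
theorem exists_regular_multipartite {K I : Type*} [Fintype K] [Fintype I] (κ : I × Bool → K)
    (hκ : ∀ i, κ (i, false) ≠ κ (i, true)) (m : ℕ) (hm : ∀ k, #{p | κ p = k} = m)
    (h j s n : ℕ) (hj : h = 0 ∨ j ≤ h)
    (hn : Fintype.card K * (m * h) + s * (m * h + j) = n) :
    ∃ G : SimpleGraph (Fin n),
      G.IsRegularOfDegree (n - (m * h + j)) ∧ G.Colorable (Fintype.card K + s) := by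
  obtain ⟨R, hR1, hR2⟩ := exists_biregular_relation h j hj
  -- Each small part is a union of `m` blocks of size `h`; `κ` sends a block to its part, and
  -- deletions take place between the blocks `(i, false)` and `(i, true)`.
  let col : (I × Bool × Fin h) ⊕ (Fin s × Fin (m * h + j)) → K ⊕ Fin s :=
    Sum.map (fun u => κ (u.1, u.2.1)) Prod.fst
  have hcard : Fintype.card (I × Bool) = Fintype.card K * m := by
    have := card_eq_sum_card_fiberwise (s := (univ : Finset (I × Bool))) (t := (univ : Finset K))
      (f := κ) (fun _ _ => by simp)
    simp only [hm, sum_const, card_univ, smul_eq_mul] at this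
    exact this
  have hV : Fintype.card ((I × Bool × Fin h) ⊕ (Fin s × Fin (m * h + j))) = n := by
    rw [← hn]
    simp only [Fintype.card_sum, Fintype.card_prod, Fintype.card_fin] at hcard ⊢
    rw [← mul_assoc, hcard]
    ring
  have hfib : ∀ u : I × Bool × Fin h,
      #(univ.filter fun v => col v = col (.inl u)) = m * h := by
    rintro ⟨i, b, x⟩
    have : m * h = #((univ.filter fun p => κ p = κ (i, b)) ×ˢ (univ : Finset (Fin h))) := by
      rw [card_product, hm, card_univ, Fintype.card_fin]
    refine .trans ?_ this.symm
    symm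
    refine card_bij (fun p _ => .inl (p.1.1, p.1.2, p.2)) ?_ ?_ ?_
    · rintro ⟨⟨i', b'⟩, y⟩ hy
      rw [mem_filter]
      simpa [col] using hy
    · rintro ⟨⟨i', b'⟩, y⟩ _ ⟨⟨i'', b''⟩, z⟩ _
      simp
      tauto
    · rintro (⟨i', b', y⟩ | v) hv <;> rw [mem_filter] at hv
      · simp [col] at hv
        exact ⟨((i', b'), y), by simp [hv], rfl⟩
      · simp [col] at hv
  have hfib' : ∀ u : Fin s × Fin (m * h + j),
      #(univ.filter fun v => col v = col (.inr u)) = m * h + j := by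
    rintro ⟨c, x⟩
    refine .trans ?_ (Finset.card_fin (m * h + j))
    symm
    refine card_bij (fun y _ => .inr (c, y)) (fun y _ => by rw [mem_filter]; simp [col])
      (by intros; simp_all) ?_
    rintro (u | ⟨c', y⟩) hv <;> rw [mem_filter] at hv <;> simp [col] at hv
    exact ⟨y, by simp, by simp [hv]⟩
  obtain ⟨G, hG, ⟨C⟩⟩ := exists_regular_of_multipartite_sdiff col (matchedPairs I _ R)
    (by
      rintro (⟨i, _ | _, x⟩ | u) (⟨i', _ | _, y⟩ | v) <;> simp [col]
      · rintro rfl _; exact hκ i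
      · rintro rfl _; exact (hκ i).symm) (m * h + j) n hV (by
      rintro (u | u)
      · rw [matchedPairs_degree R j hR1 hR2]
        convert congrArg (· + j) (hfib u)
      · rw [matchedPairs_degree_inr, add_zero]
        convert hfib' u)
  refine ⟨G, hG, ?_⟩
  have := C.colorable
  simpa using this

open scoped Classical in
/-- An even number `2 * p` of parts of size `b`, and `s` parts of size `b + j`. -/
theorem exists_regular_of_even_parts (p b j s n : ℕ) (hj : b = 0 ∨ j ≤ b)
    (hn : 2 * p * b + s * (b + j) = n) :
    ∃ G : SimpleGraph (Fin n), G.IsRegularOfDegree (n - (b + j)) ∧ G.Colorable (2 * p + s) := by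
  have := exists_regular_multipartite (K := Fin p × Bool) (I := Fin p) id (by simp) 1
    (by intro k; simp [filter_eq']) b j s n hj (by simp [← hn, mul_comm p 2])
  simpa [mul_comm p 2] using this

open scoped Classical in
/-- At least two parts of even size `2 * h`, and `s` parts of size `2 * h + j`. -/
theorem exists_regular_of_even_size (p h j s n : ℕ) (hp : 2 ≤ p) (hj : h = 0 ∨ j ≤ h)
    (hn : p * (2 * h) + s * (2 * h + j) = n) :
    ∃ G : SimpleGraph (Fin n),
      G.IsRegularOfDegree (n - (2 * h + j)) ∧ G.Colorable (p + s) := by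
  obtain ⟨p, rfl⟩ : ∃ t, p = t + 2 := ⟨p - 2, by omega⟩
  -- Part `k` consists of the blocks `(k, false)` and `(k - 1, true)`, so deletions run around a
  -- cycle of parts.
  have := exists_regular_multipartite (K := Fin (p + 2)) (I := Fin (p + 2))
    (fun x => if x.2 then x.1 + 1 else x.1) (by simp) 2
    (by
      intro k
      refine .trans ?_ (card_pair (a := (k, false)) (b := (k - 1, true)) (by simp))
      congr 1
      ext ⟨x, _ | _⟩ <;> simp [eq_sub_iff_add_eq]) h j s n hj (by simp [← hn])
  simpa using this

/-- A regular complete multipartite graph with `r` parts. -/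
theorem exists_regular_of_dvd (r q : ℕ) :
    ∃ G : SimpleGraph (Fin (r * q)), ∃ _ : G.LocallyFinite,
      G.IsRegularOfDegree (r * q - q) ∧ G.Colorable r := by
  classical
  -- No small parts; the excess `j = q` is the full size of the `r` others.
  have := exists_regular_of_even_parts 0 0 q r (r * q) (.inl rfl) (by simp)
  simp only [zero_add, mul_zero] at this
  obtain ⟨G, h⟩ := this
  exact ⟨G, _, h⟩

/-! ### From degrees of regular graphs to bounds on `rex` -/

theorem free_of_colorable {V W : Type*} {F : SimpleGraph W} {G : SimpleGraph V} {r : ℕ}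
    (hG : G.Colorable r) (hF : ¬ F.Colorable r) : F.Free G :=
  fun ⟨f⟩ => hF (hG.of_hom f.toHom)

theorem not_colorable_completeGraph (r : ℕ) : ¬ (completeGraph (Fin (r + 1))).Colorable r := by
  intro h
  have := chromaticNumber_le_iff_colorable.2 h
  rw [completeGraph, chromaticNumber_top, Fintype.card_fin] at this
  norm_cast at this
  omega

section rex

variable {n d : ℕ} {W : Type*} {F : SimpleGraph W}

open scoped Classical in
theorem mul_eq_two_mul_card_edgeFinset {G : SimpleGraph (Fin n)} (hG : G.IsRegularOfDegree d) :
    n * d = 2 * #G.edgeFinset := by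
  rw [← sum_degrees_eq_twice_card_edges, sum_congr rfl fun v _ => hG.degree_eq v]
  simp

open scoped Classical in
theorem mul_le_two_mul_rex {G : SimpleGraph (Fin n)} (hG : G.IsRegularOfDegree d)
    (hF : F.Free G) : n * d ≤ 2 * rex n F := by
  rw [mul_eq_two_mul_card_edgeFinset hG]
  gcongr
  exact le_sup (f := fun G : SimpleGraph (Fin n) => #G.edgeFinset)
    (mem_filter.2 ⟨mem_univ _, ⟨d, hG⟩, hF⟩)

open scoped Classical in
theorem two_mul_rex_le {B : ℕ}
    (h : ∀ (G : SimpleGraph (Fin n)) (d : ℕ), G.IsRegularOfDegree d → F.Free G → n * d ≤ B) :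
    2 * rex n F ≤ B := by
  have : rex n F ≤ B / 2 := by
    refine Finset.sup_le fun G hG => ?_
    obtain ⟨-, ⟨d, hd⟩, hF⟩ := mem_filter.1 hG
    have := h G d hd hF
    rw [mul_eq_two_mul_card_edgeFinset hd] at this
    omega
  omega

open scoped Classical in
theorem rex_le_extremalNumber : rex n F ≤ extremalNumber n F := by
  refine Finset.sup_le fun G hG => ?_
  have := card_edgeFinset_le_extremalNumber (mem_filter.1 hG).2.2
  rwa [Fintype.card_fin] at this

open scoped Classical in
theorem mul_le_two_mul_extremalNumber {G : SimpleGraph (Fin n)} (hG : G.IsRegularOfDegree d)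
    (hF : F.Free G) : n * d ≤ 2 * extremalNumber n F :=
  (mul_le_two_mul_rex hG hF).trans (Nat.mul_le_mul_left 2 rex_le_extremalNumber)

end rex

/-! ### Exact values for complete graphs -/

/-- Twice the Turán number is `n * n` minus the sum of the squared part sizes, and `s * (q + 1) ^ 2
+ t * q ^ 2 = n * (q + 1) - t * q`. -/
theorem two_mul_extremalNumber_completeGraph {n q r s t : ℕ} (hr : r = s + t) (ht : 0 < t)
    (hn : n = q * r + s) :
    2 * extremalNumber n (completeGraph (Fin (r + 1))) + n * (q + 1) = n * n + t * q := by
  subst hr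
  classical
  obtain ⟨u, rfl⟩ : ∃ u, t = u + 1 := ⟨t - 1, by omega⟩
  have : Nontrivial (Fin (s + (u + 1) + 1)) := Fin.nontrivial_iff_two_le.2 (by omega)
  have hmod : n % (s + (u + 1)) = s := by
    rw [hn, mul_comm, Nat.mul_add_mod, Nat.mod_eq_of_lt (by omega)]
  have h1 : (n ^ 2 - s ^ 2) * (s + (u + 1) - 1)
      = (q * (q * (s + u + 1) + 2 * s) * (s + u)) * (s + u + 1) := by
    have : n ^ 2 - s ^ 2 = q * (s + u + 1) * (q * (s + u + 1) + 2 * s) := by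
      rw [hn]
      apply Nat.sub_eq_of_eq_add
      ring
    rw [this, show s + (u + 1) - 1 = s + u by omega]
    ring
  rw [completeGraph, extremalNumber_top, Fintype.card_fin, Nat.add_sub_cancel]
  have h2 := card_edgeFinset_turanGraph (n := n) (r := s + (u + 1))
  rw [hmod, h1, show 2 * (s + (u + 1)) = 2 * (s + u + 1) by ring,
    Nat.mul_div_mul_right _ _ (by omega)] at h2
  have h3 : 2 ∣ q * (q * (s + u + 1) + 2 * s) * (s + u) := by
    have : Even ((s + u) * (s + u + 1)) := Nat.even_mul_succ_self _
    obtain ⟨c, hc⟩ := this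
    refine ⟨q * q * c + q * s * (s + u), ?_⟩
    linear_combination q * q * hc
  have h4 : 2 ∣ s * (s - 1) := (Nat.even_mul_pred_self s).two_dvd
  rw [Nat.choose_two_right] at h2
  have h5 : 2 * #(turanGraph n (s + (u + 1))).edgeFinset
      = q * (q * (s + u + 1) + 2 * s) * (s + u) + s * (s - 1) := by
    rw [← Nat.mul_div_cancel' h3, ← Nat.mul_div_cancel' h4, ← mul_add, ← h2]
  have h6 : s * (s - 1) + s = s * s := by
    rcases s with _ | s
    · rfl
    · simp; ring
  have h7 : 2 * #(turanGraph n (s + (u + 1))).edgeFinset + s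
      = q * (q * (s + u + 1) + 2 * s) * (s + u) + s * s := by omega
  have h8 : 2 * #(turanGraph n (s + (u + 1))).edgeFinset + s + n * (q + 1)
      = n * n + (u + 1) * q + s := by
    rw [h7, hn]
    ring
  linarith

/-- A regular `K_{r+1}`-free graph on `qr+s` vertices, `0 < s`, has degree at most `n-q-1`. -/
theorem two_mul_rex_completeGraph_add_le {n q s t : ℕ} (hs : 0 < s) (ht : 0 < t)
    (hn : n = q * (s + t) + s) :
    2 * rex n (completeGraph (Fin (s + t + 1))) + t * q
      ≤ 2 * extremalNumber n (completeGraph (Fin (s + t + 1))) := by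
  classical
  have hex := two_mul_extremalNumber_completeGraph rfl ht hn
  have hqn : q + 1 ≤ n := by
    rw [hn]; nlinarith
  obtain ⟨m, hm⟩ : ∃ m, n = q + 1 + m := ⟨n - (q + 1), by omega⟩
  have key : 2 * rex n (completeGraph (Fin (s + t + 1))) ≤ n * m := by
    refine two_mul_rex_le fun G d hG hF => ?_
    have h1 := mul_le_two_mul_extremalNumber hG hF
    gcongr
    -- Degree `m + 1` would need `n * (m + 1) ≤ n * m + t * q`, but `t * q < n`.
    by_contra! h
    have h2 : n * (m + 1) ≤ n * d := by gcongr; omega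
    nlinarith
  have : n * n = n * (q + 1) + n * m := by
    conv_lhs => enter [2]; rw [hm]
    ring
  omega

theorem rex_completeGraph_of_dvd {n r : ℕ} (hr : 0 < r) (h : r ∣ n) :
    rex n (completeGraph (Fin (r + 1))) = extremalNumber n (completeGraph (Fin (r + 1))) := by
  classical
  obtain ⟨q, rfl⟩ := h
  refine le_antisymm rex_le_extremalNumber ?_
  obtain ⟨G, _, hG, hc⟩ := exists_regular_of_dvd r q
  have h1 := mul_le_two_mul_rex (by convert hG)
    (free_of_colorable hc (not_colorable_completeGraph r))
  have h2 := two_mul_extremalNumber_completeGraph (n := r * q) (q := q) (s := 0)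
    (zero_add r).symm hr (by ring)
  obtain ⟨u, rfl⟩ : ∃ u, r = u + 1 := ⟨r - 1, by omega⟩
  rw [show (u + 1) * q - q = u * q by rw [add_mul, one_mul, Nat.add_sub_cancel]] at h1
  nlinarith

/-- Removing a perfect matching between parts of size `q` needs `t` even, or `q` even with `t ≥ 2`.
-/
theorem two_mul_rex_completeGraph_add_eq {n q s t : ℕ} (hs : 0 < s) (ht : 2 ≤ t)
    (hn : n = q * (s + t) + s) (he : Even t ∨ Even q) :
    2 * rex n (completeGraph (Fin (s + t + 1))) + t * q
      = 2 * extremalNumber n (completeGraph (Fin (s + t + 1))) := by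
  classical
  refine le_antisymm (two_mul_rex_completeGraph_add_le hs (by omega) hn) ?_
  have key : ∃ G : SimpleGraph (Fin n),
      G.IsRegularOfDegree (n - (q + 1)) ∧ G.Colorable (s + t) := by
    rcases he with ⟨p, hp⟩ | ⟨h, hh⟩
    · obtain ⟨G, hG, hc⟩ := exists_regular_of_even_parts p q 1 s n (by omega)
        (by rw [hn, hp]; ring)
      exact ⟨G, hG, by convert hc using 1; omega⟩
    · obtain ⟨G, hG, hc⟩ := exists_regular_of_even_size t h 1 s n ht (by omega)
        (by rw [hn, hh]; ring)
      refine ⟨G, by convert hG using 1; omega, by convert hc using 1; omega⟩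
  obtain ⟨G, hG, hc⟩ := key
  have h1 := mul_le_two_mul_rex hG (free_of_colorable hc (not_colorable_completeGraph _))
  have hex := two_mul_extremalNumber_completeGraph rfl (by omega) hn
  have hqn : q + 1 ≤ n := by
    rw [hn]; nlinarith
  obtain ⟨m, hm⟩ : ∃ m, n = q + 1 + m := ⟨n - (q + 1), by omega⟩
  rw [show n - (q + 1) = m by omega] at h1
  have : n * n = n * (q + 1) + n * m := by
    conv_lhs => enter [2]; rw [hm]
    ring
  omega

/-! ### Linear loss for every large `n` -/

/-- Nearly optimal regular `r`-colorable graphs on any number of vertices. -/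
theorem mul_le_two_mul_rex_of_not_colorable {r : ℕ} (hr : 3 ≤ r) {W : Type*} {F : SimpleGraph W}
    (hF : ¬ F.Colorable r) {n : ℕ} (hn : 4 * r * r ≤ n) :
    n * n ≤ 2 * rex n F + n * (n / r + 2 * r) := by
  classical
  -- The graph has `p = r - 1 ≥ 2` parts of even size `2 * h` and one part of size `2 * h + j` that
  -- takes the remainder; `n ≥ 4 * r * r` makes `h ≥ 2 * r > j`.
  obtain ⟨p, rfl⟩ : ∃ p, r = p + 1 := ⟨r - 1, by omega⟩
  set h := n / (2 * (p + 1)) with hh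
  set j := n % (2 * (p + 1)) with hj
  have hdiv : 2 * (p + 1) * h + j = n := Nat.div_add_mod _ _
  have hj' : j < 2 * (p + 1) := Nat.mod_lt _ (by omega)
  have hjh : j ≤ h := by
    refine hj'.le.trans ?_
    rw [hh, Nat.le_div_iff_mul_le (by omega)]
    nlinarith
  obtain ⟨G, hG, hc⟩ := exists_regular_of_even_size p h j 1 n (by omega) (.inr hjh)
    (by rw [← hdiv]; ring)
  have h1 := mul_le_two_mul_rex hG (free_of_colorable hc hF)
  have h2 : 2 * h ≤ n / (p + 1) := by
    rw [Nat.le_div_iff_mul_le (by omega)]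
    nlinarith
  have h3 : n * n ≤ n * (n - (2 * h + j)) + n * (2 * h + j) := by
    rw [← mul_add]
    gcongr
    omega
  have h4 : n * (2 * h + j) ≤ n * (n / (p + 1) + 2 * (p + 1)) := by
    gcongr
  omega

theorem linear_gap_completeGraph {r : ℕ} (hr : 3 ≤ r) {n : ℕ} (hn : 4 * r * r ≤ n)
    (hrn : ¬ r ∣ n) :
    1 / (4 * (r : ℝ)) * n ≤ (extremalNumber n (completeGraph (Fin (r + 1))) : ℝ) -
        rex n (completeGraph (Fin (r + 1))) ∧
      (extremalNumber n (completeGraph (Fin (r + 1))) : ℝ) -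
        rex n (completeGraph (Fin (r + 1))) ≤ r * n := by
  set q := n / r with hq
  set s := n % r with hs
  have hdiv : r * q + s = n := Nat.div_add_mod _ _
  have hs0 : 0 < s := Nat.pos_of_ne_zero fun h => hrn (Nat.dvd_of_mod_eq_zero h)
  have hsr : s < r := Nat.mod_lt _ (by omega)
  obtain ⟨t, ht⟩ : ∃ t, r = s + t := ⟨r - s, by omega⟩
  have hn' : n = q * r + s := by rw [← hdiv]; ring
  have h1 := two_mul_rex_completeGraph_add_le (n := n) (q := q) (t := t) hs0 (by omega)
    (by rw [← ht]; exact hn')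
  rw [← ht] at h1
  have h2 := two_mul_extremalNumber_completeGraph ht (by omega) hn'
  have h3 := mul_le_two_mul_rex_of_not_colorable hr (not_colorable_completeGraph r) hn
  rw [← hq] at h3
  have htq : t * q ≤ n := by
    rw [hn', mul_comm]
    have : q * t ≤ q * r := by gcongr; omega
    omega
  have hq1 : 1 ≤ q := by
    rw [hq, Nat.le_div_iff_mul_le (by omega)]
    nlinarith
  -- As `t, q ≥ 1`, the loss `t * q / 2` is at least `n / (4 * r)`.
  have h4 : n ≤ 2 * r * (t * q) := by
    have h5 : q * 1 ≤ q * t := by gcongr; omega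
    have h6 : r * 1 ≤ r * q := by gcongr
    nlinarith
  have hr0 : (0 : ℝ) < r := by positivity
  generalize rex n (completeGraph (Fin (r + 1))) = a at *
  generalize extremalNumber n (completeGraph (Fin (r + 1))) = b at *
  have h1' : (2 * a + t * q : ℝ) ≤ 2 * b := by exact_mod_cast h1
  have h4' : (n : ℝ) ≤ 2 * r * (t * q) := by exact_mod_cast h4
  constructor
  · rw [one_div_mul_eq_div, div_le_iff₀ (by positivity)]
    nlinarith
  · have h7 : b ≤ a + r * n := by nlinarith
    have : (b : ℝ) ≤ a + r * n := by exact_mod_cast h7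
    linarith

/-! ### Erdős–Stone and the asymptotics for general `F` -/

/-- Delete a vertex of minimum degree from an extremal graph. -/
theorem extremalNumber_le_pred_add_minDegree {n : ℕ} {W : Type*} {F : SimpleGraph W}
    (hF : F ≠ ⊥) : ∃ G : SimpleGraph (Fin (n + 1)),
      ∃ _ : DecidableRel G.Adj, F.Free G ∧
        extremalNumber (n + 1) F ≤ extremalNumber n F + G.minDegree := by
  obtain ⟨G, _, hG⟩ := exists_isExtremal_free (V := Fin (n + 1)) hF
  have hG' := isExtremal_free_iff.1 hG
  refine ⟨G, inferInstance, hG'.1, ?_⟩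
  obtain ⟨v, hv⟩ := G.exists_minimal_degree_vertex
  have h1 := card_edgeFinset_deleteIncidenceSet_le_extremalNumber hG'.1 v
  have h2 := hG'.2
  rw [Fintype.card_fin] at h1 h2
  have h3 := G.card_edgeFinset_deleteIncidenceSet v
  rw [← h2]
  rw [h3, Nat.add_sub_cancel] at h1
  omega

/-- The **Erdős–Stone theorem**: the edge density of `F`-free graphs is asymptotically at most
`1 - 1 / r` if `F` is `(r + 1)`-colorable. -/
theorem eventually_two_mul_extremalNumber_le {W : Type*} [Finite W] {F : SimpleGraph W}
    {r : ℕ} (hr : 0 < r) (hF : F.Colorable (r + 1)) (hF0 : F ≠ ⊥) {ε : ℝ} (hε : 0 < ε) :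
    ∀ᶠ n : ℕ in atTop, (2 * extremalNumber n F : ℝ) ≤ (1 - 1 / r + ε) * n ^ 2 := by
  classical
  have := Fintype.ofFinite W
  -- One `δ` serves the minimum-degree version of the theorem, the other absorbs the lower-order
  -- terms after summing from `N` to `n`.
  set δ := ε / 2 with hδ
  have hδ0 : 0 < δ := by positivity
  obtain ⟨C⟩ := hF
  have hcont : F ⊑ completeEquipartiteGraph (r + 1) (Fintype.card W) :=
    isContained_completeEquipartiteGraph_of_colorable C _ fun c => Fintype.card_subtype_le _
  obtain ⟨N, hN⟩ := eventually_atTop.1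
    (eventually_completeEquipartiteGraph_isContained_of_minDegree hδ0 r (Fintype.card W))
  set c : ℝ := 1 - 1 / r with hc
  have hc0 : 0 ≤ c := by
    rw [hc, sub_nonneg, div_le_one (by positivity)]
    exact_mod_cast hr
  have hc1 : c ≤ 1 := by
    rw [hc, sub_le_self_iff]; positivity
  have step : ∀ n ≥ N, (extremalNumber (n + 1) F : ℝ)
      ≤ extremalNumber n F + (c + δ) * (n + 1) := by
    intro n hn
    obtain ⟨G, _, hG, hle⟩ := extremalNumber_le_pred_add_minDegree (n := n) hF0
    have hdeg : (G.minDegree : ℝ) < (c + δ) * (n + 1) := by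
      by_contra! h
      exact hG (hcont.trans (hN (n + 1) (by omega) (G := G) (by push_cast; exact h)))
    have : (extremalNumber (n + 1) F : ℝ) ≤ extremalNumber n F + G.minDegree := by
      exact_mod_cast hle
    linarith
  have bound : ∀ n ≥ N, (2 * extremalNumber n F : ℝ)
      ≤ 2 * extremalNumber N F + (c + δ) * (n * (n + 1)) := by
    intro n hn
    induction n, hn using Nat.le_induction with
    | base =>
      have : 0 ≤ (c + δ) * ((N : ℝ) * (N + 1)) := by positivity
      linarith
    | succ n hn ih =>
      have := step n hn
      push_cast
      nlinarith
  filter_upwards [eventually_ge_atTop N, eventually_ge_atTop 1,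
    eventually_ge_atTop ⌈(2 * extremalNumber N F + 1 + δ) / δ⌉₊] with n h1 h2 h3
  have h3' : 2 * extremalNumber N F + 1 + δ ≤ n * δ := (div_le_iff₀ hδ0).1 (Nat.ceil_le.1 h3)
  have h2' : (1 : ℝ) ≤ n := by exact_mod_cast h2
  have hex : (0 : ℝ) ≤ extremalNumber N F := by positivity
  have := bound n h1
  have h5 : (2 * extremalNumber N F : ℝ) * 1 ≤ 2 * extremalNumber N F * n := by gcongr
  have h6 : (2 * extremalNumber N F + 1 + δ) * n ≤ n * δ * n := by gcongr
  have h7 : (c + δ) * n ≤ (1 + δ) * n := by gcongr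
  have h8 : ε = 2 * δ := by rw [hδ]; ring
  rw [h8]
  nlinarith

theorem rex_isEquivalent_extremalNumber {W : Type*} [Finite W] (F : SimpleGraph W)
    (hF : 4 ≤ F.chromaticNumber) :
    Asymptotics.IsEquivalent atTop (fun n : ℕ => (rex n F : ℝ))
      (fun n : ℕ => (extremalNumber n F : ℝ)) := by
  classical
  have := Fintype.ofFinite W
  obtain ⟨r, hr3, hr, hr'⟩ : ∃ r, 3 ≤ r ∧ F.Colorable (r + 1) ∧ ¬ F.Colorable r := by
    obtain ⟨m, hm⟩ := ENat.ne_top_iff_exists.1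
      (chromaticNumber_ne_top_iff_exists.2 ⟨_, F.colorable_of_fintype⟩)
    rw [← hm] at hF
    have hm4 : 4 ≤ m := by exact_mod_cast hF
    obtain ⟨r, rfl⟩ : ∃ r, m = r + 1 := ⟨m - 1, by omega⟩
    refine ⟨r, by omega, chromaticNumber_le_iff_colorable.1 hm.ge, fun h => ?_⟩
    have := chromaticNumber_le_iff_colorable.2 h
    rw [← hm] at this
    norm_cast at this
    omega
  have hF0 : F ≠ ⊥ := by
    rintro rfl
    exact hr' ⟨⟨fun _ => ⟨0, by omega⟩, fun h => h.elim⟩⟩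
  have hr0 : (3 : ℝ) ≤ r := by exact_mod_cast hr3
  refine Asymptotics.isLittleO_iff.2 fun ε hε => ?_
  filter_upwards [eventually_two_mul_extremalNumber_le (by omega) hr hF0
    (show (0 : ℝ) < ε / 4 by positivity), eventually_ge_atTop (4 * r * r),
    eventually_ge_atTop (12 * r), eventually_ge_atTop ⌈2 * r / (ε / 4)⌉₊] with n h1 h2 h3 h4
  have h5 := mul_le_two_mul_rex_of_not_colorable hr3 hr' h2
  have h6 : rex n F ≤ extremalNumber n F := rex_le_extremalNumber
  have h6' : (rex n F : ℝ) ≤ extremalNumber n F := by exact_mod_cast h6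
  have h5' : (n : ℝ) * n ≤ 2 * rex n F + n * (n / r + 2 * r) := by
    have : (n : ℝ) * n ≤ 2 * rex n F + n * ((n / r : ℕ) + 2 * r) := by exact_mod_cast h5
    have h7 : ((n / r : ℕ) : ℝ) ≤ n / r := Nat.cast_div_le
    nlinarith
  have h4' : 2 * (r : ℝ) ≤ n * (ε / 4) := (div_le_iff₀ (by positivity)).1 (Nat.ceil_le.1 h4)
  have h3' : 12 * (r : ℝ) ≤ n := by exact_mod_cast h3
  simp only [Pi.sub_apply, Real.norm_eq_abs]
  rw [abs_sub_comm, abs_of_nonneg (by linarith), abs_of_nonneg (by positivity)]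
  have h7 : (n : ℝ) / r ≤ n / 3 := by gcongr
  have h8 : (1 - 1 / (r : ℝ) + ε / 4) * n ^ 2 = n * n - n * (n / r) + ε / 4 * (n * n) := by
    field_simp
  rw [h8] at h1
  have hn0 : (0 : ℝ) ≤ n := by positivity
  have h9 : (n : ℝ) * (2 * r) ≤ n * (n * (ε / 4)) := by gcongr
  have h10 : (n : ℝ) * (12 * r) ≤ n * n := by gcongr
  have h11 : (n : ℝ) * (n / r) ≤ n * (n / 3) := by gcongr
  -- The quadratic error must be compared with `extremalNumber n F`, which is itself at least `n * n
  -- / 4`.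
  have h12 : (n : ℝ) * n ≤ 4 * extremalNumber n F := by nlinarith
  have h13 : ε * ((n : ℝ) * n) ≤ ε * (4 * extremalNumber n F) := by gcongr
  nlinarith

/-! ### The case of `K_4` -/

open scoped Classical in
/-- A `3`-colorable regular graph on `3k+2` vertices with `k ≠ 0` does not have degree `2k+1`. -/
theorem not_colorable_of_isRegularOfDegree {k : ℕ} (hk : 0 < k)
    {G : SimpleGraph (Fin (3 * k + 2))} (hG : G.IsRegularOfDegree (2 * k + 1)) :
    ¬ G.Colorable 3 := by
  rintro ⟨C⟩
  let f : Fin 3 → ℕ := fun c => #{v | C v = c}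
  have hsum : f 0 + f 1 + f 2 = 3 * k + 2 := by
    have := card_eq_sum_card_fiberwise (s := (univ : Finset (Fin (3 * k + 2))))
      (t := (univ : Finset (Fin 3))) (f := C) (fun _ _ => by simp)
    rw [card_univ, Fintype.card_fin, Fin.sum_univ_three] at this
    exact this.symm
  have hcompl : ∀ c, f c + #{v | C v ≠ c} = 3 * k + 2 := by
    intro c
    have := card_filter_add_card_filter_not (s := (univ : Finset (Fin (3 * k + 2))))
      (fun v => C v = c)
    rw [card_univ, Fintype.card_fin] at this
    exact this
  have hsub : ∀ v, G.neighborFinset v ⊆ ({w | C w ≠ C v} : Finset _) := by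
    intro v w hw
    rw [mem_neighborFinset] at hw
    simpa using (C.valid hw).symm
  have hle : ∀ c, f c ≤ k + 1 := by
    intro c
    rcases Nat.eq_zero_or_pos (f c) with h | h
    · omega
    · obtain ⟨v, hv⟩ := card_pos.1 h
      have hv' : C v = c := by simpa using hv
      have h1 := card_le_card (hsub v)
      rw [card_neighborFinset_eq_degree, hG.degree_eq, hv'] at h1
      have := hcompl c
      omega
  -- The colour classes have sizes `k, k + 1, k + 1`. Vertices of the larger classes are joined to
  -- everything outside their class, so a vertex of the smallest has degree `2 * k + 2`.
  obtain ⟨c, hc, hne⟩ : ∃ c, f c = k ∧ ∀ c', c' ≠ c → f c' = k + 1 := by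
    have h0 := hle 0
    have h1 := hle 1
    have h2 := hle 2
    by_cases a0 : f 0 = k
    · refine ⟨0, a0, fun c' hc' => ?_⟩
      fin_cases c' <;> simp at hc' ⊢ <;> omega
    by_cases a1 : f 1 = k
    · refine ⟨1, a1, fun c' hc' => ?_⟩
      fin_cases c' <;> simp at hc' ⊢ <;> omega
    · refine ⟨2, by omega, fun c' hc' => ?_⟩
      fin_cases c' <;> simp at hc' ⊢ <;> omega
  obtain ⟨v, hv⟩ := card_pos.1 (hc.symm ▸ hk : 0 < f c)
  have hv' : C v = c := by simpa using hv
  have hbig : ({w | C w ≠ c} : Finset _) ⊆ G.neighborFinset v := by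
    intro w hw
    have hw' : C w ≠ c := by simpa using hw
    have heq : G.neighborFinset w = ({u | C u ≠ C w} : Finset _) := by
      refine eq_of_subset_of_card_le (hsub w) ?_
      rw [card_neighborFinset_eq_degree, hG.degree_eq]
      have := hcompl (C w)
      have := hne _ hw'
      omega
    have : v ∈ G.neighborFinset w := by
      rw [heq]
      simpa [hv'] using hw'.symm
    rw [mem_neighborFinset] at this ⊢
    exact this.symm
  have h1 := card_le_card hbig
  rw [card_neighborFinset_eq_degree, hG.degree_eq] at h1
  have := hcompl c
  omega

theorem two_mul_rex_K4_le {k : ℕ} (hk0 : k ≠ 0) (hk2 : k ≠ 2) :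
    2 * rex (3 * k + 2) (completeGraph (Fin 4)) ≤ (3 * k + 2) * (2 * k) := by
  classical
  refine two_mul_rex_le fun G d hG hF => ?_
  gcongr
  by_contra! hd
  have hex := two_mul_extremalNumber_completeGraph (n := 3 * k + 2) (q := k) (r := 3) (s := 2)
    (t := 1) rfl (by omega) (by ring)
  have h1 := mul_le_two_mul_extremalNumber hG hF
  norm_num at hex
  have hd' : d = 2 * k + 1 := by
    by_contra hne
    have h2 : (3 * k + 2) * (2 * k + 2) ≤ (3 * k + 2) * d := by gcongr; omega
    nlinarith
  subst hd'
  have h3 := mul_eq_two_mul_card_edgeFinset hG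
  -- For `k = 1, 3` the degree sum `(3 * k + 2) * (2 * k + 1)` is odd. For `k ≥ 4` the degree
  -- exceeds `5 / 8` of the order, which forces 3-colourability.
  have hk4 : 4 ≤ k := by
    by_contra! h
    interval_cases k <;> omega
  refine not_colorable_of_isRegularOfDegree (by omega) hG
    (colorable_of_cliqueFree_lt_minDegree (r := 3) ?_ ?_)
  · exact cliqueFree_iff_top_free.2 hF
  · rw [hG.minDegree_eq, Fintype.card_fin]
    omega

/-- Parts `k, k, k + 2` work when `k ≥ 2`, since a 2-regular bipartite graph must be removed; for `k
= 1` the 5-cycle replaces them. -/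
theorem le_two_mul_rex_K4 {k : ℕ} (hk : k ≠ 0) :
    (3 * k + 2) * (2 * k) ≤ 2 * rex (3 * k + 2) (completeGraph (Fin 4)) := by
  classical
  rcases Nat.lt_or_ge k 2 with h | h
  · obtain rfl : k = 1 := by omega
    have hreg : (cycleGraph 5).IsRegularOfDegree 2 := fun v => by
      convert cycleGraph_degree_three_le (n := 2) (v := v)
    refine mul_le_two_mul_rex (d := 2) (G := cycleGraph 5) (by convert hreg)
      (free_of_colorable (r := 3) ?_ (not_colorable_completeGraph 3))
    exact chromaticNumber_le_iff_colorable.1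
      (chromaticNumber_cycleGraph_of_odd 5 (by omega) (by decide)).le
  · obtain ⟨G, hG, hc⟩ := exists_regular_of_even_parts 1 k 2 1 (3 * k + 2) (.inr h) (by ring)
    have := mul_le_two_mul_rex hG (free_of_colorable hc (not_colorable_completeGraph 3))
    rwa [show 3 * k + 2 - (k + 2) = 2 * k by omega] at this

theorem rex_K4 {n k s : ℕ} (hn : n = 3 * k + s) (hs : s ≤ 2) (h2 : n ≠ 2) (h8 : n ≠ 8) :
    rex n (completeGraph (Fin 4)) = k * n := by
  interval_cases s
  · have h1 := rex_completeGraph_of_dvd (n := n) (r := 3) (by omega) ⟨k, by omega⟩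
    have hex := two_mul_extremalNumber_completeGraph (n := n) (q := k) (r := 3) (s := 0)
      (t := 3) rfl (by omega) (by omega)
    norm_num at h1 hex
    subst hn
    nlinarith
  · have h1 := two_mul_rex_completeGraph_add_eq (n := n) (q := k) (s := 1) (t := 2) (by omega)
      (by omega) (by omega) (.inl (by decide))
    have hex := two_mul_extremalNumber_completeGraph (n := n) (q := k) (r := 3) (s := 1)
      (t := 2) rfl (by omega) (by omega)
    norm_num at h1 hex
    subst hn
    nlinarith
  · subst hn
    have h1 := two_mul_rex_K4_le (k := k) (by omega) (by omega)
    have h3 := le_two_mul_rex_K4 (k := k) (by omega)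
    nlinarith

end RegularTuran

theorem theorem1 (r : ℕ) (hr : 3 ≤ r) :
    -- (i)
    (∀ n : ℕ, r ∣ n →
      RegularTuran.rex n (SimpleGraph.completeGraph (Fin (r + 1))) =
        SimpleGraph.extremalNumber n (SimpleGraph.completeGraph (Fin (r + 1)))) ∧
    -- (ii)
    (∃ c C : ℝ, 0 < c ∧ 0 < C ∧ ∃ N : ℕ, ∀ n : ℕ, N ≤ n → ¬ r ∣ n →
      c * (n : ℝ) ≤
        (SimpleGraph.extremalNumber n (SimpleGraph.completeGraph (Fin (r + 1))) : ℝ) -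
          (RegularTuran.rex n (SimpleGraph.completeGraph (Fin (r + 1))) : ℝ) ∧
      (SimpleGraph.extremalNumber n (SimpleGraph.completeGraph (Fin (r + 1))) : ℝ) -
          (RegularTuran.rex n (SimpleGraph.completeGraph (Fin (r + 1))) : ℝ) ≤ C * (n : ℝ)) ∧
    -- (iii)
    (∀ n q s : ℕ, n = q * r + s → 1 ≤ s → s + 2 ≤ r → (Even (r - s) ∨ Even q) →
      (RegularTuran.rex n (SimpleGraph.completeGraph (Fin (r + 1))) : ℝ) =
        (SimpleGraph.extremalNumber n (SimpleGraph.completeGraph (Fin (r + 1))) : ℝ) -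
          ((r : ℝ) - (s : ℝ)) * (q : ℝ) / 2) ∧
    -- (iv)
    (∀ {W : Type*} [Finite W] (F : SimpleGraph W), 4 ≤ F.chromaticNumber →
      Asymptotics.IsEquivalent Filter.atTop
        (fun n : ℕ => (RegularTuran.rex n F : ℝ))
        (fun n : ℕ => (SimpleGraph.extremalNumber n F : ℝ))) ∧
    -- (v)
    (∀ n k s : ℕ, n = 3 * k + s → s ≤ 2 → n ≠ 2 → n ≠ 8 →
      RegularTuran.rex n (SimpleGraph.completeGraph (Fin 4)) = k * n ∧
      k * n = n * (n / 3)) := by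
  refine ⟨fun n hn => RegularTuran.rex_completeGraph_of_dvd (by omega) hn,
    ⟨1 / (4 * r), r, by positivity, by positivity, 4 * r * r,
      fun n hn hrn => RegularTuran.linear_gap_completeGraph hr hn hrn⟩,
    fun n q s hn hs hsr he => ?_, fun F hF => RegularTuran.rex_isEquivalent_extremalNumber F hF,
    fun n k s hn hs h2 h8 => ⟨RegularTuran.rex_K4 hn hs h2 h8, ?_⟩⟩
  · obtain ⟨t, rfl⟩ : ∃ t, r = s + t := ⟨r - s, by omega⟩
    rw [Nat.add_sub_cancel_left] at he
    have h := RegularTuran.two_mul_rex_completeGraph_add_eq hs (by omega) hn he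
    have h' : (2 * (RegularTuran.rex n (SimpleGraph.completeGraph (Fin (s + t + 1))) : ℝ) + t * q)
        = 2 * SimpleGraph.extremalNumber n (SimpleGraph.completeGraph (Fin (s + t + 1))) := by
      exact_mod_cast h
    push_cast
    linarith
  · rw [show n / 3 = k by omega, mul_comm]
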